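/- All graphs are finite and simple. A \emph{cover} of a graph $G$ is a pair $\mathcal{H}=(L,H)$ of a graph $H$ and a map $L$ assigning to each $u\in V(G)$ a set $L(u)\subseteq V(H)$, such that the sets $L(u)$ partition $V(H)$, each $L(u)$ is a clique of $H$, every edge of $H$ between distinct sets $L(u)$ and $L(v)$ satisfies $uv\in E(G)$, and for each $uv\in E(G)$ the edges of $H$ between $L(u)$ and $L(v)$ form a (possibly empty, not necessarily perfect) matching. The cover is \emph{$k$-fold} if $|L(u)|=k$ for all $u$. For $\eta\in[0,1]$, an \emph{$(\eta,\mathcal{H})$-coloring} of $G$ is a set $S\subseteq V(H)$ such that $H$ has no edge between $S\cap L(u)$ and $S\cap L(v)$ for distinct $u,v$, and $|S\cap L(u)|\ge \eta|L(u)|$ for all $u\in V(G)$. Let $$\theta_{DP}(G,k)=\max\{\eta\in[0,1] : G \text{ has an } (\eta,\mathcal{H})\text{-coloring for every } k\text{-fold cover } \mathcal{H} \text{ of } G\},$$ $$\chi^*_{DP}(G)=\inf\{\theta_{DP}(G,k)^{-1} : k\in\mathbb{N},\ k\ge 1\},$$ where $0^{-1}=\infty$. \textbf{Theorem.} There is a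 function $\varepsilon\colon\mathbb{N}\to\mathbb{R}$ with $\varepsilon(d)\to 0$ as $d\to\infty$ such that the following holds for every integer $d\ge 2$. Suppose that a graph $G$ has an acyclic orientation $D$ such that (D1) the maximum out-degree of $D$ is at most $d$; and (D2) for every arc $uv$ of $D$, there is no directed path from $u$ to $v$ of even length in $D$. Then $$\chi^*_{DP}(G)\le (1+\varepsilon(d))\,\frac{d}{\ln d}.$$ -/

import Mathlib

open Filter Topology

universe u

/-- A cover `(L, H)` of a graph `G`, where the graph `H` has vertex set `W`. -/
structure DPCover {V : Type u} (G : SimpleGraph V) (W : Type u) where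
  /-- The graph `H` of the cover. -/
  H : SimpleGraph W
  /-- The list of each vertex. -/
  L : V → Set W
  /-- The lists partition the vertex set of `H`. -/
  partition : ∀ x : W, ∃! v : V, x ∈ L v
  /-- Every list induces a complete subgraph. -/
  clique : ∀ v : V, H.IsClique (L v)
  /-- Edges between different lists lie over edges of `G`. -/
  edge_over : ∀ v w : V, ∀ x ∈ L v, ∀ y ∈ L w, H.Adj x y → v = w ∨ G.Adj v w
  /-- The edges between two adjacent lists form a (not necessarily perfect) matching: no vertex of
  `L v` has two neighbors in `L w`. As `G.Adj` is symmetric, the same holds with the roles of `v`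
  and `w` exchanged. -/
  matching : ∀ v w : V, G.Adj v w →
    ∀ x ∈ L v, ∀ y ∈ L w, ∀ z ∈ L w, H.Adj x y → H.Adj x z → y = z

namespace DPCover

variable {V W : Type u} {G : SimpleGraph V}

/-- All lists have size `k`. -/
def IsFold (C : DPCover G W) (k : ℕ) : Prop :=
  ∀ v : V, (C.L v).ncard = k

/-- `S` spans no cross-edge, i.e. no edge of `H` between different lists. -/
def QuasiIndependent (C : DPCover G W) (S : Set W) : Prop :=
  ∀ v w : V, v ≠ w → ∀ x ∈ S ∩ C.L v, ∀ y ∈ S ∩ C.L w, ¬ C.H.Adj x y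

/-- `S` is an `(η, H)`-coloring. -/
def IsColoring (C : DPCover G W) (η : ℝ) (S : Set W) : Prop :=
  C.QuasiIndependent S ∧ ∀ v : V, η * ((C.L v).ncard : ℝ) ≤ ((S ∩ C.L v).ncard : ℝ)

end DPCover

/-- The numbers `η ∈ [0,1]` such that `G` has an `(η, H)`-coloring for every `k`-fold cover. -/
def dpRatios {V : Type u} (G : SimpleGraph V) (k : ℕ) : Set ℝ :=
  {η : ℝ | η ∈ Set.Icc (0 : ℝ) 1 ∧
    ∀ (W : Type u) [Finite W] (C : DPCover G W), C.IsFold k → ∃ S : Set W, C.IsColoring η S}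

/-- The quantity `θ_DP(G, k)`. The supremum is a maximum, see `isGreatest_thetaDP`. -/
noncomputable def thetaDP {V : Type u} (G : SimpleGraph V) (k : ℕ) : ℝ :=
  sSup (dpRatios G k)

theorem isGreatest_thetaDP {V : Type u} (G : SimpleGraph V) (k : ℕ) :
    IsGreatest (dpRatios G k) (thetaDP G k) := by
  have hne : (dpRatios G k).Nonempty :=
    ⟨0, ⟨le_rfl, zero_le_one⟩, fun W _ C _ =>
      ⟨∅, fun v w _ x hx => absurd hx.1 (Set.notMem_empty x), fun v => by simp⟩⟩
  have hbd : BddAbove (dpRatios G k) := ⟨1, fun η h => h.1.2⟩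
  have hcl : IsClosed (dpRatios G k) := by
    have : dpRatios G k = Set.Icc (0 : ℝ) 1 ∩
        ⋂ (W : Type u) (_ : Finite W) (C : DPCover G W) (_ : C.IsFold k),
          ⋃ S : Set W, {η : ℝ | C.IsColoring η S} := by
      ext η
      simp [dpRatios]
    rw [this]
    refine isClosed_Icc.inter (isClosed_iInter fun W => isClosed_iInter fun _ =>
      isClosed_iInter fun C => isClosed_iInter fun _ => isClosed_iUnion_of_finite fun S => ?_)
    simp only [DPCover.IsColoring, Set.ofPred_and, Set.ofPred_forall]
    exact isClosed_const.inter (isClosed_iInter fun v =>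
      isClosed_le (continuous_id.mul continuous_const) continuous_const)
  exact ⟨hcl.csSup_mem hne hbd, fun η h => le_csSup hbd h⟩

/-- The fractional DP-chromatic number, `inf {θ_DP(G, k)⁻¹ : k ≥ 1}`. It is taken in `[0, ∞]`, so
that `θ_DP(G, k)⁻¹ = ∞` when `θ_DP(G, k) = 0`. -/
noncomputable def fracDPChromaticNumber {V : Type u} (G : SimpleGraph V) : ENNReal :=
  ⨅ (k : ℕ) (_ : 1 ≤ k), (ENNReal.ofReal (thetaDP G k))⁻¹

namespace Digraph

variable {V : Type u}

/-- `D` arises from `G` by giving each edge exactly one of its two directions. -/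
def IsOrientationOf (D : Digraph V) (G : SimpleGraph V) : Prop :=
  (∀ v w : V, G.Adj v w ↔ D.Adj v w ∨ D.Adj w v) ∧ ∀ v w : V, D.Adj v w → ¬ D.Adj w v

/-- There are no directed cycles: no vertex is reachable from itself by a directed walk of positive
length. -/
def IsAcyclic (D : Digraph V) : Prop :=
  ∀ v : V, ¬ Relation.TransGen D.Adj v v

/-- There is a directed path from `v` to `w` of length `n` (with `n` arcs). -/
def HasDirectedPath (D : Digraph V) (v w : V) (n : ℕ) : Prop :=
  ∃ p : Fin (n + 1) → V, Function.Injective p ∧ p 0 = v ∧ p (Fin.last n) = w ∧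
    ∀ i : Fin n, D.Adj (p i.castSucc) (p i.succ)

end Digraph

/-!
Lift the orientation `D` to the cover graph `H`, give every vertex of `H` an independent coin, and
treat the vertices of `H` from the sinks upwards, selecting `x` when its coin shows `true` and none
of its out-neighbors has been selected. No two selected vertices span a cross-edge. Let `q` be
the inverse of `d / t + exp t`. Once every out-neighbor of `x` is selected with probability `q`, by
means of coins of bias at most `q * exp t`, the probability that none of them is selected is at
least `exp (-t)`, and some bias of at most `q * exp t` for the coin of `x` makes `x` selected with
probability `q` as well.

The bound `exp (-t)` is where (D2) enters: every walk in `H` between two out-neighbors of `x` has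
even length, so switching off the coins of all these out-neighbors never unblocks one of them, and
none of them is selected if and only if each shows `false` or is blocked after the switching-off.
The latter blocking is independent of their coins, and Jensen's inequality gives the bound.

The selection of `x` only depends on the coins of vertices reachable from `x`, so it is correlated
with the selection of boundedly many other vertices. By a second moment argument, for large `k` the
selected set meets all lists in more than `η * k` vertices, for any fixed `η < q`. Finally
`t = log d - 2 * log (log d)` gives the asymptotics.
-/

section Coins

open MeasureTheory ProbabilityTheory

theorem exp_neg_div_one_sub_le {s P : ℝ} (hs : 0 ≤ s) (hsP : s ≤ P) (hP : P < 1) :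
    Real.exp (-(s / (1 - P))) ≤ 1 - s := by
  have hs1 : 0 < 1 - s := by linarith
  calc Real.exp (-(s / (1 - P))) ≤ Real.exp (-(s / (1 - s))) := by gcongr
    _ ≤ (s / (1 - s) + 1)⁻¹ := by
        rw [Real.exp_neg]
        gcongr
        exact Real.add_one_le_exp _
    _ = 1 - s := by field_simp; ring

theorem exp_neg_sum_integral_div_le_integral_prod_one_sub {Ω ι : Type*} [MeasurableSpace Ω]
    {μ : Measure Ω} [IsProbabilityMeasure μ] {f : ι → Ω → ℝ} {P : ℝ} (hP : P < 1) {Y : Finset ι}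
    (hf : ∀ y ∈ Y, AEMeasurable (f y) μ) (hfP : ∀ y ∈ Y, ∀ ω, f y ω ∈ Set.Icc 0 P) :
    Real.exp (-((∑ y ∈ Y, ∫ ω, f y ω ∂μ) / (1 - P))) ≤ ∫ ω, ∏ y ∈ Y, (1 - f y ω) ∂μ := by
  have : 0 < 1 - P := sub_pos.2 hP
  have hint (y : ι) (hy : y ∈ Y) : Integrable (f y) μ :=
    .of_mem_Icc 0 P (hf y hy) (.of_forall (hfP y hy))
  have hfac (y : ι) (hy : y ∈ Y) (ω : Ω) : 1 - f y ω ∈ Set.Icc 0 1 :=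
    ⟨by linarith [(hfP y hy ω).2], by linarith [(hfP y hy ω).1]⟩
  have hprod (ω : Ω) : ∏ y ∈ Y, (1 - f y ω) ∈ Set.Icc 0 1 :=
    ⟨Finset.prod_nonneg fun y hy => (hfac y hy ω).1,
      Finset.prod_le_one (fun y hy => (hfac y hy ω).1) fun y hy => (hfac y hy ω).2⟩
  have hpoint (ω : Ω) :
      Real.exp (-((∑ y ∈ Y, f y ω) / (1 - P))) ≤ ∏ y ∈ Y, (1 - f y ω) := by
    simp only [Finset.sum_div, ← Finset.sum_neg_distrib, Real.exp_sum]
    exact Finset.prod_le_prod (fun _ _ => (Real.exp_pos _).le) fun y hy =>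
      exp_neg_div_one_sub_le (hfP y hy ω).1 (hfP y hy ω).2 hP
  have hsum : AEMeasurable (fun ω => ∑ y ∈ Y, f y ω) μ := Finset.aemeasurable_fun_sum Y hf
  have hexp : Integrable (fun ω => Real.exp (-((∑ y ∈ Y, f y ω) / (1 - P)))) μ :=
    .of_mem_Icc 0 1 (Real.measurable_exp.comp_aemeasurable (hsum.div_const _).neg)
      (.of_forall fun ω => ⟨(Real.exp_pos _).le, (hpoint ω).trans (hprod ω).2⟩)
  calc Real.exp (-((∑ y ∈ Y, ∫ ω, f y ω ∂μ) / (1 - P)))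
      = Real.exp (∫ ω, -((∑ y ∈ Y, f y ω) / (1 - P)) ∂μ) := by
        rw [integral_neg, integral_div, integral_finsetSum _ hint]
    _ ≤ ∫ ω, Real.exp (-((∑ y ∈ Y, f y ω) / (1 - P))) ∂μ :=
        convexOn_exp.map_integral_le Real.continuous_exp.continuousOn isClosed_univ
          (by simp) ((integrable_finsetSum _ hint).div_const _).neg hexp
    _ ≤ ∫ ω, ∏ y ∈ Y, (1 - f y ω) ∂μ :=
        integral_mono hexp (.of_mem_Icc 0 1
          (Finset.aemeasurable_fun_prod Y fun y hy => (hf y hy).const_sub 1)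
          (.of_forall hprod)) hpoint

/-- The law of independent coins, the `i`-th of which shows `true` with probability `p i`. -/
noncomputable def coinMeasure {ι : Type*} (p : ι → unitInterval) : Measure (ι → Bool) :=
  Measure.infinitePi fun i => bernoulliMeasure true false (p i)

instance {ι : Type*} (p : ι → unitInterval) : IsProbabilityMeasure (coinMeasure p) := by
  unfold coinMeasure
  infer_instance

theorem integral_coinMeasure_coin {ι : Type*} (p : ι → unitInterval) (i : ι) :
    ∫ ω, (if ω i then 1 else 0 : ℝ) ∂coinMeasure p = p i := by
  have hmap : (coinMeasure p).map (fun ω => ω i) = bernoulliMeasure true false (p i) :=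
    Measure.infinitePi_map_eval _ i
  calc ∫ ω, (if ω i then 1 else 0 : ℝ) ∂coinMeasure p
      = ∫ b, (if b then 1 else 0 : ℝ) ∂bernoulliMeasure true false (p i) := by
        rw [← hmap, integral_map (measurable_pi_apply i).aemeasurable (by fun_prop)]
    _ = p i := by simp [integral_bernoulliMeasure]

variable {ι : Type*} [Finite ι]

theorem measureReal_coinMeasure_eq_integral (p : ι → unitInterval) (A : (ι → Bool) → Prop)
    [DecidablePred A] :
    (coinMeasure p).real {ω | A ω} = ∫ ω, (if A ω then 1 else 0) ∂coinMeasure p := by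
  rw [← integral_indicator_one .of_discrete]
  simp [Set.indicator_apply]

theorem measureReal_coinMeasure_congr {p p' : ι → unitInterval} {A : (ι → Bool) → Prop} {s : Set ι}
    (hA : DependsOn A s) (h : ∀ i ∈ s, p i = p' i) :
    (coinMeasure p).real {ω | A ω} = (coinMeasure p').real {ω | A ω} := by
  obtain ⟨A', rfl⟩ := dependsOn_iff_exists_comp.1 hA
  have hrestrict (p : ι → unitInterval) : (coinMeasure p).real {ω | (A' ∘ s.domRestrict) ω} =
      (coinMeasure fun i : s => p i).real {ω | A' ω} := by
    have hmap : (coinMeasure p).map s.domRestrict = coinMeasure fun i : s => p i :=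
      Measure.infinitePi_map_restrict' _
    rw [← hmap, map_measureReal_apply (by fun_prop) .of_discrete]
    rfl
  rw [hrestrict, hrestrict, funext fun i : s => h i i.2]

theorem indepFun_coinMeasure_of_dependsOn (p : ι → unitInterval) {β γ : Type*} [MeasurableSpace β]
    [MeasurableSpace γ] {f : (ι → Bool) → β} {g : (ι → Bool) → γ} {s t : Set ι}
    (hst : Disjoint s t) (hf : DependsOn f s) (hg : DependsOn g t) :
    IndepFun f g (coinMeasure p) := by
  classical
  have := Fintype.ofFinite ι
  have : Nonempty β := ⟨f fun _ => true⟩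
  have : Nonempty γ := ⟨g fun _ => true⟩
  rw [← s.coe_toFinset] at hf
  rw [← t.coe_toFinset] at hg
  obtain ⟨f', rfl⟩ := dependsOn_iff_exists_comp.1 hf
  obtain ⟨g', rfl⟩ := dependsOn_iff_exists_comp.1 hg
  have hcoins : iIndepFun (fun i (ω : ι → Bool) => ω i) (coinMeasure p) :=
    iIndepFun_infinitePi (X := fun _ b => b) (by fun_prop)
  exact (hcoins.indepFun_finset _ _ (Set.disjoint_toFinset.2 hst) (by fun_prop)).comp
    .of_discrete .of_discrete

theorem integral_coin_mul (p : ι → unitInterval) (i : ι) {f : (ι → Bool) → ℝ}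
    (hf : DependsOn f {i}ᶜ) :
    ∫ ω, (if ω i then 1 else 0) * f ω ∂coinMeasure p = p i * ∫ ω, f ω ∂coinMeasure p := by
  have hcoin : DependsOn (fun ω : ι → Bool => (if ω i then 1 else 0 : ℝ)) {i} :=
    fun ω ω' h => by simp only [h i rfl]
  rw [(indepFun_coinMeasure_of_dependsOn p disjoint_compl_right hcoin hf
    ).integral_fun_mul_eq_mul_integral .of_discrete .of_discrete, integral_coinMeasure_coin]

theorem measureReal_coin_and (p : ι → unitInterval) (i : ι) {A : (ι → Bool) → Prop}
    (hA : DependsOn A {i}ᶜ) :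
    (coinMeasure p).real {ω | ω i ∧ A ω} = p i * (coinMeasure p).real {ω | A ω} := by
  classical
  have h := integral_coin_mul p i (f := fun ω => if A ω then 1 else 0)
    fun ω ω' h => by simp only [hA h]
  simpa only [measureReal_coinMeasure_eq_integral, ← ite_and, ite_mul, one_mul, zero_mul] using h

theorem integral_prod_one_sub_coin_mul_mul (p : ι → unitInterval) {s : Set ι}
    {f : ι → (ι → Bool) → ℝ} (hf : ∀ i, DependsOn (f i) sᶜ) (Y : Finset ι) (hY : ↑Y ⊆ s)
    {g : (ι → Bool) → ℝ} (hg : DependsOn g sᶜ) :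
    ∫ ω, (∏ i ∈ Y, (1 - (if ω i then 1 else 0) * f i ω)) * g ω ∂coinMeasure p =
      ∫ ω, (∏ i ∈ Y, (1 - p i * f i ω)) * g ω ∂coinMeasure p := by
  classical
  induction Y using Finset.induction_on generalizing g with
  | empty => simp
  | insert a Y ha ih =>
    rw [Finset.coe_insert, Set.insert_subset_iff] at hY
    set Q : (ι → Bool) → ℝ := fun ω => ∏ i ∈ Y, (1 - (if ω i then 1 else 0) * f i ω)
    have hsa : sᶜ ⊆ {a}ᶜ := Set.compl_subset_compl.2 (Set.singleton_subset_iff.2 hY.1)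
    have hrest : DependsOn (fun ω => f a ω * (Q ω * g ω)) {a}ᶜ := fun ω ω' h => by
      have hQ : Q ω = Q ω' := Finset.prod_congr rfl fun i hi => by
        rw [h i (ne_of_mem_of_not_mem hi ha), (hf i).mono hsa h]
      simp only [(hf a).mono hsa h, hg.mono hsa h, hQ]
    calc ∫ ω, (∏ i ∈ insert a Y, (1 - (if ω i then 1 else 0) * f i ω)) * g ω ∂coinMeasure p
        = ∫ ω, (Q ω * g ω - (if ω a then 1 else 0) * (f a ω * (Q ω * g ω))) ∂coinMeasure p := by
          simp only [Finset.prod_insert ha, Q]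
          congr with ω
          ring
      _ = ∫ ω, (Q ω * g ω - p a * (f a ω * (Q ω * g ω))) ∂coinMeasure p := by
          rw [integral_sub .of_finite .of_finite, integral_sub .of_finite .of_finite,
            integral_coin_mul p a hrest, integral_const_mul]
      _ = ∫ ω, Q ω * ((1 - p a * f a ω) * g ω) ∂coinMeasure p := by
          congr with ω
          ring
      _ = ∫ ω, (∏ i ∈ Y, (1 - p i * f i ω)) * ((1 - p a * f a ω) * g ω) ∂coinMeasure p :=
          ih hY.2 fun ω ω' h => by simp only [hf a h, hg h]
      _ = _ := by
          simp only [Finset.prod_insert ha]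
          congr with ω
          ring

theorem exp_neg_sum_div_le_measureReal_forall_not {p : ι → unitInterval} {P : ℝ} (hP : P < 1)
    {Y : Finset ι} (hp : ∀ y ∈ Y, p y ≤ P) {B : ι → (ι → Bool) → Prop}
    (hB : ∀ y, DependsOn (B y) (↑Y : Set ι)ᶜ) :
    Real.exp (-((∑ y ∈ Y, (coinMeasure p).real {ω | ω y ∧ B y ω}) / (1 - P))) ≤
      (coinMeasure p).real {ω | ∀ y ∈ Y, ¬(ω y ∧ B y ω)} := by
  classical
  set b : ι → (ι → Bool) → ℝ := fun y ω => if B y ω then 1 else 0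
  have hb (y : ι) : DependsOn (b y) (↑Y : Set ι)ᶜ := fun ω ω' h => by simp only [b, hB y h]
  have hmean (y : ι) (hy : y ∈ Y) : (coinMeasure p).real {ω | ω y ∧ B y ω} =
      ∫ ω, p y * b y ω ∂coinMeasure p := by
    have hy' : (↑Y : Set ι)ᶜ ⊆ {y}ᶜ := by simpa using hy
    rw [measureReal_coin_and p y ((hB y).mono hy'), measureReal_coinMeasure_eq_integral,
      integral_const_mul]
  have hpb (y : ι) (hy : y ∈ Y) (ω : ι → Bool) : p y * b y ω ∈ Set.Icc 0 P := by
    by_cases hBω : B y ω <;> simp [b, hBω, hp y hy, (p y).2.1, (p y).2.1.trans (hp y hy)]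
  calc Real.exp (-((∑ y ∈ Y, (coinMeasure p).real {ω | ω y ∧ B y ω}) / (1 - P)))
      = Real.exp (-((∑ y ∈ Y, ∫ ω, p y * b y ω ∂coinMeasure p) / (1 - P))) := by
        rw [Finset.sum_congr rfl hmean]
    _ ≤ ∫ ω, ∏ y ∈ Y, (1 - p y * b y ω) ∂coinMeasure p :=
        exp_neg_sum_integral_div_le_integral_prod_one_sub hP
          (fun _ _ => Measurable.of_discrete.aemeasurable) hpb
    _ = ∫ ω, ∏ y ∈ Y, (1 - (if ω y then 1 else 0) * b y ω) ∂coinMeasure p := by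
        simpa using (integral_prod_one_sub_coin_mul_mul p hb Y subset_rfl
          (g := fun _ => 1) (fun _ _ _ => rfl)).symm
    _ = (coinMeasure p).real {ω | ∀ y ∈ Y, ¬(ω y ∧ B y ω)} := by
        have hfactor (y : ι) (ω : ι → Bool) : 1 - (if ω y then 1 else 0) * b y ω =
            if ¬(ω y ∧ B y ω) then 1 else 0 := by
          by_cases hy : B y ω <;> cases ω y <;> simp [b, hy]
        simp only [hfactor, Finset.prod_ite_zero, Finset.prod_const_one,
          measureReal_coinMeasure_eq_integral]

end Coins

section SecondMoment

open MeasureTheory ProbabilityTheory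

theorem ncard_inter_eq_sum_indicator {Ω ι : Type*} {S : Ω → Set ι} {s : Finset ι} (ω : Ω) :
    ((S ω ∩ s).ncard : ℝ) = ∑ x ∈ s, {ω | x ∈ S ω}.indicator (1 : Ω → ℝ) ω := by
  classical
  simp only [Set.indicator_apply, Set.mem_ofPred_eq, Pi.one_apply, Finset.sum_boole]
  rw [← Set.ncard_coe_finset, Finset.coe_filter, Set.inter_comm]
  rfl

variable {Ω ι : Type*} [MeasurableSpace Ω] {μ : Measure Ω} [IsProbabilityMeasure μ]

theorem covariance_le_one_of_mem_Icc {X Y : Ω → ℝ} (hX : AEMeasurable X μ) (hY : AEMeasurable Y μ)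
    (hX01 : ∀ ω, X ω ∈ Set.Icc 0 1) (hY01 : ∀ ω, Y ω ∈ Set.Icc 0 1) :
    covariance X Y μ ≤ 1 := by
  have hX2 : MemLp X 2 μ := memLp_of_bounded (.of_forall hX01) hX.aestronglyMeasurable 2
  have hY2 : MemLp Y 2 μ := memLp_of_bounded (.of_forall hY01) hY.aestronglyMeasurable 2
  have hXY : ∫ ω, (X * Y) ω ∂μ ≤ ∫ _, 1 ∂μ :=
    integral_mono (hX2.integrable_mul hY2) (integrable_const 1) fun ω =>
      mul_le_one₀ (hX01 ω).2 (hY01 ω).1 (hY01 ω).2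
  have hX0 : 0 ≤ ∫ ω, X ω ∂μ := integral_nonneg fun ω => (hX01 ω).1
  have hY0 : 0 ≤ ∫ ω, Y ω ∂μ := integral_nonneg fun ω => (hY01 ω).1
  rw [covariance_eq_sub hX2 hY2]
  simp only [integral_const, probReal_univ, smul_eq_mul, mul_one] at hXY
  nlinarith

theorem variance_sum_le_card_mul {s : Finset ι} {X : ι → Ω → ℝ} {M : ℕ}
    (hX : ∀ i, AEMeasurable (X i) μ) (hX01 : ∀ i ω, X i ω ∈ Set.Icc 0 1)
    (hM : ∀ i ∈ s, {j | j ∈ s ∧ ¬ IndepFun (X i) (X j) μ}.ncard ≤ M) :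
    variance (fun ω => ∑ i ∈ s, X i ω) μ ≤ s.card * M := by
  classical
  have hX2 (i : ι) : MemLp (X i) 2 μ :=
    memLp_of_bounded (.of_forall (hX01 i)) (hX i).aestronglyMeasurable 2
  rw [variance_fun_sum' fun i _ => hX2 i, ← nsmul_eq_mul]
  refine Finset.sum_le_card_nsmul _ _ _ fun i hi => ?_
  calc ∑ j ∈ s, covariance (X i) (X j) μ
      ≤ ∑ j ∈ s, if IndepFun (X i) (X j) μ then 0 else 1 := by
        refine Finset.sum_le_sum fun j _ => ?_
        split_ifs with hij
        · exact (hij.covariance_eq_zero (hX2 i) (hX2 j)).le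
        · exact covariance_le_one_of_mem_Icc (hX i) (hX j) (hX01 i) (hX01 j)
    _ = (({j ∈ s | ¬ IndepFun (X i) (X j) μ} : Finset ι).card : ℝ) := by
        simp [Finset.sum_ite]
    _ ≤ M := by
        rw [← Set.ncard_coe_finset, Finset.coe_filter]
        exact_mod_cast hM i hi

theorem exists_forall_abs_sub_integral_lt [Finite ι] {X : ι → Ω → ℝ}
    (hX : ∀ i, MemLp (X i) 2 μ) {B c : ℝ} (hB : ∀ i, variance (X i) μ ≤ B)
    (hc : 0 ≤ c) (hBc : Nat.card ι * B < c ^ 2) :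
    ∃ ω, ∀ i, |X i ω - ∫ ω', X i ω' ∂μ| < c := by
  have := Fintype.ofFinite ι
  have hint (i : ι) : Integrable (fun ω => (X i ω - ∫ ω', X i ω' ∂μ) ^ 2) μ :=
    ((hX i).sub (memLp_const _)).integrable_sq
  obtain ⟨ω, hω⟩ := exists_le_integral
    (integrable_finsetSum Finset.univ fun i _ => hint i)
  refine ⟨ω, fun i => abs_lt_of_sq_lt_sq ?_ hc⟩
  calc (X i ω - ∫ ω', X i ω' ∂μ) ^ 2 ≤ ∑ j, (X j ω - ∫ ω', X j ω' ∂μ) ^ 2 :=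
        Finset.single_le_sum (f := fun j => (X j ω - ∫ ω', X j ω' ∂μ) ^ 2)
          (fun _ _ => sq_nonneg _) (Finset.mem_univ i)
    _ ≤ ∑ j, variance (X j) μ := by
        refine hω.trans_eq ?_
        rw [integral_finsetSum _ fun j _ => hint j]
        exact Finset.sum_congr rfl fun j _ =>
          (variance_eq_integral (hX j).aestronglyMeasurable.aemeasurable).symm
    _ ≤ Nat.card ι * B := by
        rw [Nat.card_eq_fintype_card, ← Finset.card_univ, ← nsmul_eq_mul]
        exact Finset.sum_le_card_nsmul _ _ _ fun j _ => hB j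
    _ < c ^ 2 := hBc

section RandomSet

variable {S : Ω → Set ι} {s : Finset ι}

theorem memLp_indicator_mem (hS : ∀ x, MeasurableSet {ω | x ∈ S ω}) (x : ι) :
    MemLp ({ω | x ∈ S ω}.indicator (1 : Ω → ℝ)) 2 μ :=
  memLp_indicator_const 2 (hS x) 1 (.inr (measure_ne_top _ _))

theorem integral_ncard_inter (hS : ∀ x, MeasurableSet {ω | x ∈ S ω}) :
    ∫ ω, ((S ω ∩ s).ncard : ℝ) ∂μ = ∑ x ∈ s, μ.real {ω | x ∈ S ω} := by
  simp only [ncard_inter_eq_sum_indicator]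
  rw [integral_finsetSum _ fun x _ => (memLp_indicator_mem hS x).integrable one_le_two]
  exact Finset.sum_congr rfl fun x _ => integral_indicator_one (hS x)

theorem variance_ncard_inter_le [Finite ι] {M : ℕ} (hS : ∀ x, MeasurableSet {ω | x ∈ S ω})
    (hM : ∀ x, {y | ¬ IndepFun (fun ω => x ∈ S ω) (fun ω => y ∈ S ω) μ}.ncard ≤ M) :
    variance (fun ω => ((S ω ∩ s).ncard : ℝ)) μ ≤ s.card * M := by
  classical
  simp only [ncard_inter_eq_sum_indicator]
  refine variance_sum_le_card_mul (fun x => (memLp_indicator_mem hS x).aemeasurable)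
    (fun x ω => ?_) fun x _ => (Set.ncard_le_ncard fun y hy hxy => hy.2 ?_).trans (hM x)
  · by_cases hx : x ∈ S ω <;> simp [hx]
  · let φ (A : Prop) : ℝ := if A then 1 else 0
    have hφ (z : ι) : φ ∘ (fun ω => z ∈ S ω) = {ω | z ∈ S ω}.indicator 1 := by
      ext ω
      simp [φ, Set.indicator_apply]
    rw [← hφ, ← hφ]
    exact hxy.comp .of_discrete .of_discrete

theorem exists_forall_mul_lt_ncard_inter [Finite ι] {q η : ℝ} {M k : ℕ}
    (hS : ∀ x, MeasurableSet {ω | x ∈ S ω}) (hq : ∀ x, μ.real {ω | x ∈ S ω} = q)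
    (hM : ∀ x, {y | ¬ IndepFun (fun ω => x ∈ S ω) (fun ω => y ∈ S ω) μ}.ncard ≤ M)
    {κ : Type*} [Finite κ] {L : κ → Set ι} (hL : ∀ i, (L i).ncard = k) (hη : η < q)
    (hk : Nat.card κ * M < (q - η) ^ 2 * k) :
    ∃ ω, ∀ i, η * k < (S ω ∩ L i).ncard := by
  have hk0 : 0 < (k : ℝ) :=
    pos_of_mul_pos_right (hk.trans_le' (by positivity)) (sq_nonneg _)
  have : 0 < q - η := sub_pos.2 hη
  obtain ⟨T, rfl⟩ : ∃ T : κ → Finset ι, L = fun i => (T i : Set ι) :=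
    ⟨fun i => (L i).toFinite.toFinset, by simp⟩
  simp only [Set.ncard_coe_finset] at hL
  have hmean (i : κ) : ∫ ω, ((S ω ∩ T i).ncard : ℝ) ∂μ = q * k := by
    simp [integral_ncard_inter hS, hq, hL, mul_comm]
  have hvar (i : κ) : variance (fun ω => ((S ω ∩ T i).ncard : ℝ)) μ ≤ k * M :=
    hL i ▸ variance_ncard_inter_le hS hM
  have hL2 (i : κ) : MemLp (fun ω => ((S ω ∩ T i).ncard : ℝ)) 2 μ := by
    simp only [ncard_inter_eq_sum_indicator]
    exact memLp_finsetSum _ fun x _ => memLp_indicator_mem hS x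
  obtain ⟨ω, hω⟩ := exists_forall_abs_sub_integral_lt (c := (q - η) * k) hL2 hvar
    (by positivity) <| by
      calc Nat.card κ * (k * M : ℝ) = Nat.card κ * M * k := by ring
        _ < (q - η) ^ 2 * k * k := by gcongr
        _ = ((q - η) * k) ^ 2 := by ring
  refine ⟨ω, fun i => ?_⟩
  have hlow := (abs_lt.1 (hω i)).1
  rw [hmean] at hlow
  linarith

end RandomSet

end SecondMoment

theorem existsUnique_isFixedPt_of_wellFounded {α β : Type*} [Nonempty β] {r : α → α → Prop}
    (hr : WellFounded r) (F : (α → β) → α → β)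
    (hF : ∀ f g x, (∀ y, r y x → f y = g y) → F f x = F g x) :
    ∃! f, Function.IsFixedPt F f := by
  classical
  refine ⟨hr.fix fun x f => F (fun y => if hy : r y x then f y hy else Classical.arbitrary β) x,
    funext fun x => ?_, fun g hg => funext fun x => ?_⟩
  · rw [hr.fix_eq]
    exact hF _ _ x fun y hy => by rw [dif_pos hy]
  · induction x using hr.induction with
    | _ x ih =>
      rw [hr.fix_eq, ← hg.eq]
      exact hF _ _ x fun y hy => by rw [dif_pos hy, ih y hy]

/-- There is a walk of length `n` from `x` to `y` along the relation `r`. -/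
def HasWalk {W : Type*} (r : W → W → Prop) : ℕ → W → W → Prop
  | 0, x, y => x = y
  | n + 1, x, y => ∃ z, r x z ∧ HasWalk r n z y

section Greedy

variable {W : Type*}

/-- The coin flips `ω` with the coins in `Y` turned to `false`. -/
noncomputable def clearCoins (Y : Set W) (ω : W → Bool) : W → Bool :=
  open Classical in Y.piecewise (fun _ => false) ω

theorem clearCoins_eq_true {Y : Set W} {ω : W → Bool} {x : W} :
    clearCoins Y ω x = true ↔ x ∉ Y ∧ ω x = true := by
  by_cases hx : x ∈ Y <;> simp [clearCoins, hx]

theorem dependsOn_clearCoins (Y : Set W) : DependsOn (clearCoins Y) Yᶜ := by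
  refine fun ω ω' h => funext fun x => ?_
  by_cases hx : x ∈ Y
  · simp [clearCoins, hx]
  · simp [clearCoins, hx, h x hx]

variable [Finite W] {D : Digraph W}

theorem wellFounded_transGen_of_isAcyclic (hD : D.IsAcyclic) :
    WellFounded fun y x => Relation.TransGen D.Adj x y :=
  have : Std.Irrefl fun y x => Relation.TransGen D.Adj x y := ⟨hD⟩
  have : IsTrans W fun y x => Relation.TransGen D.Adj x y := ⟨fun _ _ _ h h' => h'.trans h⟩
  Finite.wellFounded_of_trans_of_irrefl _

theorem existsUnique_greedy (hD : D.IsAcyclic) (ω : W → Bool) :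
    ∃! S : Set W, ∀ x, x ∈ S ↔ ω x ∧ ∀ y, D.Adj x y → y ∉ S := by
  have h := existsUnique_isFixedPt_of_wellFounded (wellFounded_transGen_of_isAcyclic hD)
    (fun (S : W → Prop) x => ω x ∧ ∀ y, D.Adj x y → ¬ S y) fun S T x hST => by
      have hadj (y : W) (hy : D.Adj x y) : S y = T y := hST y (.single hy)
      grind
  obtain ⟨S, hS, huniq⟩ := h
  refine ⟨{x | S x}, fun x => (congrFun hS.eq x).symm.to_iff, fun T hT => ?_⟩
  exact Set.ext fun x => (congrFun (huniq (· ∈ T) (funext fun x => propext (hT x).symm)) x).to_iff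

/-- The set selected greedily from the vertices whose coin shows `true`, each vertex being treated
after its out-neighbors and selected when none of them is: the kernel of the digraph induced by `D`
on these vertices. -/
noncomputable def greedySet (hD : D.IsAcyclic) (ω : W → Bool) : Set W :=
  (existsUnique_greedy hD ω).choose

/-- No out-neighbor of `x` is selected greedily, so that `x` is selected once its own coin
shows `true`. -/
def Unblocked (hD : D.IsAcyclic) (ω : W → Bool) (x : W) : Prop :=
  ∀ y, D.Adj x y → y ∉ greedySet hD ω

theorem mem_greedySet {hD : D.IsAcyclic} {ω : W → Bool} {x : W} :
    x ∈ greedySet hD ω ↔ ω x ∧ Unblocked hD ω x :=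
  (existsUnique_greedy hD ω).choose_spec.1 x

theorem eq_greedySet {hD : D.IsAcyclic} {ω : W → Bool} {S : Set W}
    (hS : ∀ x, x ∈ S ↔ ω x ∧ ∀ y, D.Adj x y → y ∉ S) : S = greedySet hD ω :=
  (existsUnique_greedy hD ω).choose_spec.2 S hS

theorem dependsOn_mem_greedySet (hD : D.IsAcyclic) (x : W) :
    DependsOn (fun ω => x ∈ greedySet hD ω) {y | Relation.ReflTransGen D.Adj x y} := by
  intro ω ω' h
  induction x using (wellFounded_transGen_of_isAcyclic hD).induction with
  | _ x ih =>
    have hnbr (y : W) (hy : D.Adj x y) : y ∈ greedySet hD ω ↔ y ∈ greedySet hD ω' :=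
      (ih y (.single hy) fun z hz => h z (.head hy hz)).to_iff
    have hcoin : ω x = ω' x := h x .refl
    simp only [mem_greedySet (x := x), Unblocked, hcoin]
    grind

theorem dependsOn_unblocked (hD : D.IsAcyclic) (x : W) :
    DependsOn (fun ω => Unblocked hD ω x) {y | Relation.TransGen D.Adj x y} :=
  fun _ _ h => propext <| forall₂_congr fun y hy =>
    not_congr (dependsOn_mem_greedySet hD y fun z hz => h z (.head' hy hz)).to_iff

-- Deselecting a vertex can only help its in-neighbors, which in turn can only hurt theirs: the
-- effect of a switched-off coin alternates along walks.
theorem mem_greedySet_clearCoins_imp (hD : D.IsAcyclic) (Y : Set W) (ω : W → Bool) (x : W) :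
    ((∀ y ∈ Y, ∀ n, HasWalk D.Adj n x y → Even n) →
      x ∈ greedySet hD (clearCoins Y ω) → x ∈ greedySet hD ω) ∧
    ((∀ y ∈ Y, ∀ n, HasWalk D.Adj n x y → Odd n) →
      x ∈ greedySet hD ω → x ∈ greedySet hD (clearCoins Y ω)) := by
  induction x using (wellFounded_transGen_of_isAcyclic hD).induction with
  | _ x ih =>
    simp only [mem_greedySet (x := x), clearCoins_eq_true]
    refine ⟨fun heven hx => ⟨hx.1.2, fun z hz hzω => ?_⟩,
      fun hodd hx => ⟨⟨fun hxY => ?_, hx.1⟩, fun z hz hzω => ?_⟩⟩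
    · refine hx.2 z hz ((ih z (.single hz)).2 (fun y hy n hn => ?_) hzω)
      exact Nat.not_even_iff_odd.1 (Nat.even_add_one.1 (heven y hy (n + 1) ⟨z, hz, hn⟩))
    · exact Nat.not_odd_zero (hodd x hxY 0 rfl)
    · refine hx.2 z hz ((ih z (.single hz)).1 (fun y hy n hn => ?_) hzω)
      exact Nat.not_odd_iff_even.1 (Nat.odd_add_one.1 (hodd y hy (n + 1) ⟨z, hz, hn⟩))

theorem unblocked_of_unblocked_clearCoins {hD : D.IsAcyclic} {Y : Set W} {ω : W → Bool} {x : W}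
    (heven : ∀ y ∈ Y, ∀ n, HasWalk D.Adj n x y → Even n)
    (hx : Unblocked hD (clearCoins Y ω) x) : Unblocked hD ω x := fun z hz hzω =>
  hx z hz <| (mem_greedySet_clearCoins_imp hD Y ω z).2 (fun y hy n hn => Nat.not_even_iff_odd.1
    (Nat.even_add_one.1 (heven y hy (n + 1) ⟨z, hz, hn⟩))) hzω

theorem forall_notMem_greedySet_iff (hD : D.IsAcyclic) {Y : Set W} (ω : W → Bool)
    (hY : ∀ x ∈ Y, ∀ y ∈ Y, ∀ n, HasWalk D.Adj n x y → Even n) :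
    (∀ y ∈ Y, y ∉ greedySet hD ω) ↔
      ∀ y ∈ Y, ¬(ω y ∧ Unblocked hD (clearCoins Y ω) y) := by
  refine ⟨fun h y hy hsel => h y hy (mem_greedySet.2
    ⟨hsel.1, unblocked_of_unblocked_clearCoins (hY y hy) hsel.2⟩), fun h => ?_⟩
  have hclear : greedySet hD (clearCoins Y ω) = greedySet hD ω := by
    refine eq_greedySet fun x => ?_
    rw [mem_greedySet, clearCoins_eq_true]
    exact ⟨fun hx => ⟨hx.1.2, hx.2⟩, fun hx => ⟨⟨fun hxY => h x hxY hx, hx.1⟩, hx.2⟩⟩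
  intro y hy hyω
  rw [← hclear, mem_greedySet, clearCoins_eq_true] at hyω
  exact hyω.1.1 hy

theorem exp_neg_sum_le_measureReal_forall_notMem_greedySet (hD : D.IsAcyclic)
    {p : W → unitInterval} {P : ℝ} (hP : P < 1) {Y : Finset W} (hp : ∀ y ∈ Y, p y ≤ P)
    (hY : ∀ x ∈ Y, ∀ y ∈ Y, ∀ n, HasWalk D.Adj n x y → Even n) :
    Real.exp (-((∑ y ∈ Y, (coinMeasure p).real {ω | y ∈ greedySet hD ω}) / (1 - P))) ≤
      (coinMeasure p).real {ω | ∀ y ∈ Y, y ∉ greedySet hD ω} := by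
  have : 0 < 1 - P := by linarith
  calc Real.exp (-((∑ y ∈ Y, (coinMeasure p).real {ω | y ∈ greedySet hD ω}) / (1 - P)))
      ≤ Real.exp (-((∑ y ∈ Y, (coinMeasure p).real
          {ω | ω y ∧ Unblocked hD (clearCoins Y ω) y}) / (1 - P))) := by
        gcongr with y hy ω
        · exact MeasureTheory.measure_ne_top _ _
        · exact fun hω =>
            mem_greedySet.2 ⟨hω.1, unblocked_of_unblocked_clearCoins (hY y hy) hω.2⟩
    _ ≤ (coinMeasure p).real {ω | ∀ y ∈ Y, ¬(ω y ∧ Unblocked hD (clearCoins Y ω) y)} :=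
        exp_neg_sum_div_le_measureReal_forall_not hP hp fun y ω ω' h => by
          rw [dependsOn_clearCoins _ h]
    _ = (coinMeasure p).real {ω | ∀ y ∈ Y, y ∉ greedySet hD ω} := by
        congr with ω
        exact (forall_notMem_greedySet_iff hD ω hY).symm

theorem measureReal_mem_greedySet (hD : D.IsAcyclic) (p : W → unitInterval) (x : W) :
    (coinMeasure p).real {ω | x ∈ greedySet hD ω} =
      p x * (coinMeasure p).real {ω | Unblocked hD ω x} := by
  simp only [mem_greedySet (x := x)]
  exact measureReal_coin_and p x ((dependsOn_unblocked hD x).mono fun y hy hyx => by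
    obtain rfl : y = x := hyx
    exact hD y hy)

theorem exp_neg_le_measureReal_unblocked (hD : D.IsAcyclic) {p : W → unitInterval} {x : W}
    {d : ℕ} {q P t : ℝ} (hP : P < 1) (hq : 0 ≤ q) (hqt : d * q ≤ t * (1 - P))
    (hdeg : {y | D.Adj x y}.ncard ≤ d)
    (heven : ∀ y z, D.Adj x y → D.Adj x z → ∀ n, HasWalk D.Adj n y z → Even n)
    (hp : ∀ y, D.Adj x y → p y ≤ P)
    (hmarg : ∀ y, D.Adj x y → (coinMeasure p).real {ω | y ∈ greedySet hD ω} = q) :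
    Real.exp (-t) ≤ (coinMeasure p).real {ω | Unblocked hD ω x} := by
  classical
  have := Fintype.ofFinite W
  set Y : Finset W := {y | D.Adj x y}
  have hY {y : W} : y ∈ Y ↔ D.Adj x y := by simp [Y]
  have hP' : 0 < 1 - P := by linarith
  have hsum : (∑ y ∈ Y, (coinMeasure p).real {ω | y ∈ greedySet hD ω}) / (1 - P) ≤ t := by
    rw [Finset.sum_congr rfl fun y hy => hmarg y (hY.1 hy), Finset.sum_const, nsmul_eq_mul,
      div_le_iff₀ hP']
    refine le_trans ?_ hqt
    gcongr
    rw [← Set.ncard_coe_finset]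
    simpa [Y] using hdeg
  calc Real.exp (-t) ≤ _ := by gcongr
    _ ≤ (coinMeasure p).real {ω | ∀ y ∈ Y, y ∉ greedySet hD ω} :=
        exp_neg_sum_le_measureReal_forall_notMem_greedySet hD hP (fun y hy => hp y (hY.1 hy))
          fun y hy z hz => heven y z (hY.1 hy) (hY.1 hz)
    _ = _ := by simp only [hY, Unblocked]

theorem exists_bias_forall_measureReal_mem_greedySet_eq (hD : D.IsAcyclic) {d : ℕ} {q t : ℝ}
    (hd : 0 < d) (hq : 0 < q) (ht : 0 < t) (hqt : q * (d / t + Real.exp t) ≤ 1)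
    (hdeg : ∀ x, {y | D.Adj x y}.ncard ≤ d)
    (heven : ∀ x y z, D.Adj x y → D.Adj x z → ∀ n, HasWalk D.Adj n y z → Even n) :
    ∃ p : W → unitInterval, ∀ x, (coinMeasure p).real {ω | x ∈ greedySet hD ω} = q := by
  have hdq : d * q ≤ t * (1 - q * Real.exp t) := by
    have : q * (d / t) ≤ 1 - q * Real.exp t := by linarith
    calc d * q = t * (q * (d / t)) := by field_simp
      _ ≤ _ := by gcongr
  have hP : q * Real.exp t < 1 := by
    have : 0 < d * q := by positivity
    have := pos_of_mul_pos_right (this.trans_le hdq) ht.le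
    linarith
  -- The projection onto `[0, 1]` makes the recursion total; it turns out to act trivially.
  obtain ⟨p, hp, -⟩ := existsUnique_isFixedPt_of_wellFounded (wellFounded_transGen_of_isAcyclic hD)
    (fun p x => Set.projIcc (0 : ℝ) 1 zero_le_one
      (q / (coinMeasure p).real {ω | Unblocked hD ω x}))
    fun p p' x h => by rw [measureReal_coinMeasure_congr (dependsOn_unblocked hD x) h]
  suffices h : ∀ x, p x ≤ q * Real.exp t ∧ (coinMeasure p).real {ω | x ∈ greedySet hD ω} = q from
    ⟨p, fun x => (h x).2⟩
  intro x
  induction x using (wellFounded_transGen_of_isAcyclic hD).induction with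
  | _ x ih =>
    set b := (coinMeasure p).real {ω | Unblocked hD ω x}
    have hexp : Real.exp (-t) ≤ b :=
      exp_neg_le_measureReal_unblocked hD hP hq.le hdq (hdeg x) (heven x)
        (fun y hy => (ih y (.single hy)).1) fun y hy => (ih y (.single hy)).2
    have hb0 : 0 < b := (Real.exp_pos _).trans_le hexp
    have hqb : q / b ≤ q * Real.exp t := by
      calc q / b ≤ q / Real.exp (-t) := by gcongr
        _ = q * Real.exp t := by rw [Real.exp_neg, div_inv_eq_mul]
    have hpx : (p x : ℝ) = q / b := by
      rw [← congrFun hp.eq x, Set.projIcc_of_mem _ ⟨by positivity, hqb.trans hP.le⟩]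
    refine ⟨hpx.trans_le hqb, ?_⟩
    rw [measureReal_mem_greedySet, hpx, div_mul_cancel₀ q hb0.ne']

end Greedy

theorem HasWalk.map {V W : Type*} {r : W → W → Prop} {s : V → V → Prop} (f : W → V)
    (hf : ∀ x y, r x y → s (f x) (f y)) {n : ℕ} {x y : W} (h : HasWalk r n x y) :
    HasWalk s n (f x) (f y) := by
  induction n generalizing x with
  | zero => exact congrArg f h
  | succ n ih =>
    obtain ⟨z, hxz, hzy⟩ := h
    exact ⟨f z, hf x z hxz, ih hzy⟩

theorem HasWalk.exists_chain {W : Type*} {r : W → W → Prop} {n : ℕ} {x y : W}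
    (h : HasWalk r n x y) : ∃ p : Fin (n + 1) → W,
      p 0 = x ∧ p (Fin.last n) = y ∧ ∀ i : Fin n, r (p i.castSucc) (p i.succ) := by
  induction n generalizing x with
  | zero => exact ⟨fun _ => x, rfl, h, fun i => i.elim0⟩
  | succ n ih =>
    obtain ⟨z, hxz, hzy⟩ := h
    obtain ⟨p, rfl, hlast, hp⟩ := ih hzy
    refine ⟨Fin.cons x p, rfl, by rwa [← Fin.succ_last, Fin.cons_succ], Fin.cases hxz fun i => ?_⟩
    simpa [Fin.castSucc_succ] using hp i

theorem hasDirectedPath_of_hasWalk {V : Type*} {D : Digraph V} (hD : D.IsAcyclic) {n : ℕ} {v w : V}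
    (h : HasWalk D.Adj n v w) : D.HasDirectedPath v w n := by
  obtain ⟨p, hp0, hlast, hp⟩ := h.exists_chain
  have htrans : ∀ i j, i < j → Relation.TransGen D.Adj (p i) (p j) :=
    (Fin.liftFun_iff_succ (Relation.TransGen D.Adj)).2 fun i => .single (hp i)
  exact ⟨p, Function.Injective.of_lt_imp_ne fun i j hij heq => hD (p j) (heq ▸ htrans i j hij),
    hp0, hlast, hp⟩

theorem exists_rank_of_forall_not_transGen_self {V : Type*} [Finite V] {r : V → V → Prop}
    (hr : ∀ v, ¬ Relation.TransGen r v v) :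
    ∃ ρ : V → ℕ, (∀ v w, r v w → ρ w < ρ v) ∧ ∀ v, ρ v ≤ Nat.card V := by
  refine ⟨fun v => {w | Relation.TransGen r v w}.ncard, fun v w h => ?_,
    fun v => Set.ncard_le_card _⟩
  exact Set.ncard_lt_ncard ⟨fun z hz => .head h hz, fun hs => hr w (hs (.single h))⟩

theorem ncard_biUnion_le_card_mul {α β : Type*} {s : Finset α} {f : α → Set β} {n : ℕ}
    (h : ∀ a ∈ s, (f a).ncard ≤ n) : (⋃ a ∈ s, f a).ncard ≤ s.card * n :=
  (Finset.set_ncard_biUnion_le s f).trans (Finset.sum_le_card_nsmul _ _ _ h)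

theorem ncard_reflTransGen_le {W : Type*} [Finite W] {r : W → W → Prop} {ρ : W → ℕ} {c : ℕ}
    (hρ : ∀ x y, r x y → ρ y < ρ x) (hc : ∀ x, {y | r x y}.ncard ≤ c) {m : ℕ} {x : W}
    (hx : ρ x ≤ m) : {y | Relation.ReflTransGen r x y}.ncard ≤ (c + 1) ^ m := by
  induction m generalizing x with
  | zero =>
    have hsub : {y | Relation.ReflTransGen r x y} ⊆ {x} := fun y hy =>
      hy.cases_head.elim Eq.symm fun ⟨z, hz, _⟩ => absurd (hρ x z hz) (by omega)
    simpa using Set.ncard_le_ncard hsub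
  | succ m ih =>
    have hfin : {z | r x z}.Finite := Set.toFinite _
    have hsub : {y | Relation.ReflTransGen r x y} ⊆
        insert x (⋃ z ∈ hfin.toFinset, {y | Relation.ReflTransGen r z y}) := fun y hy =>
      hy.cases_head.imp Eq.symm fun ⟨z, hz, hzy⟩ => by simpa using ⟨z, hz, hzy⟩
    calc {y | Relation.ReflTransGen r x y}.ncard
        ≤ (⋃ z ∈ hfin.toFinset, {y | Relation.ReflTransGen r z y}).ncard + 1 :=
          (Set.ncard_le_ncard hsub).trans (Set.ncard_insert_le _ _)
      _ ≤ hfin.toFinset.card * (c + 1) ^ m + 1 := by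
          gcongr
          exact ncard_biUnion_le_card_mul fun z hz =>
            ih (Nat.le_of_lt_succ ((hρ x z (by simpa using hz)).trans_le hx))
      _ ≤ c * (c + 1) ^ m + (c + 1) ^ m := by
          gcongr
          · rw [← Set.ncard_eq_toFinset_card]
            exact hc x
          · exact Nat.one_le_pow' _ _
      _ = (c + 1) ^ (m + 1) := by ring

open ProbabilityTheory in
theorem ncard_not_indepFun_mem_greedySet_le {W : Type*} [Finite W] {D : Digraph W}
    (hD : D.IsAcyclic) (p : W → unitInterval) {a b : ℕ}
    (ha : ∀ x, {y | Relation.ReflTransGen D.Adj x y}.ncard ≤ a)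
    (hb : ∀ y, {x | Relation.ReflTransGen D.Adj x y}.ncard ≤ b) (x : W) :
    {y | ¬ IndepFun (fun ω => x ∈ greedySet hD ω) (fun ω => y ∈ greedySet hD ω)
      (coinMeasure p)}.ncard ≤ a * b := by
  have hfin : {z | Relation.ReflTransGen D.Adj x z}.Finite := Set.toFinite _
  have hsub : {y | ¬ IndepFun (fun ω => x ∈ greedySet hD ω) (fun ω => y ∈ greedySet hD ω)
      (coinMeasure p)} ⊆ ⋃ z ∈ hfin.toFinset, {y | Relation.ReflTransGen D.Adj y z} := by
    intro y hy
    have hmeet := mt (fun h => indepFun_coinMeasure_of_dependsOn p h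
      (dependsOn_mem_greedySet hD x) (dependsOn_mem_greedySet hD y)) hy
    obtain ⟨z, hxz, hyz⟩ := Set.not_disjoint_iff.1 hmeet
    simpa using ⟨z, hxz, hyz⟩
  calc _ ≤ hfin.toFinset.card * b :=
        (Set.ncard_le_ncard hsub).trans (ncard_biUnion_le_card_mul fun z _ => hb z)
    _ ≤ a * b := by
        gcongr
        rw [← Set.ncard_eq_toFinset_card]
        exact ha x

namespace DPCover

open ProbabilityTheory

variable {V W : Type u} {G : SimpleGraph V} (C : DPCover G W) {D : Digraph V}

/-- The vertex of `G` whose list contains `x`. -/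
noncomputable def proj (x : W) : V :=
  (C.partition x).choose

theorem mem_L_iff {x : W} {v : V} : x ∈ C.L v ↔ C.proj x = v := by
  have h := (C.partition x).choose_spec
  exact ⟨fun hx => (h.2 v hx).symm, fun hv => hv ▸ h.1⟩

theorem injOn_proj (x : W) :
    Set.InjOn C.proj {y | C.H.Adj x y ∧ G.Adj (C.proj x) (C.proj y)} := fun y hy z hz hyz =>
  C.matching _ _ hy.2 x (C.mem_L_iff.2 rfl) y (C.mem_L_iff.2 rfl) z (C.mem_L_iff.2 hyz.symm)
    hy.1 hz.1

/-- The orientation of the cross-edges of the cover induced by an orientation `D` of `G`. -/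
def lift (D : Digraph V) : Digraph W where
  Adj x y := C.H.Adj x y ∧ D.Adj (C.proj x) (C.proj y)

theorem isAcyclic_lift (hD : D.IsAcyclic) : (C.lift D).IsAcyclic := fun x hx =>
  hD (C.proj x) (hx.lift C.proj fun _ _ h => h.2)

theorem ncard_lift_adj_le [Finite V] (hDG : D.IsOrientationOf G) (x : W) :
    {y | (C.lift D).Adj x y}.ncard ≤ {w | D.Adj (C.proj x) w}.ncard :=
  have hsub : {y | (C.lift D).Adj x y} ⊆ {y | C.H.Adj x y ∧ G.Adj (C.proj x) (C.proj y)} :=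
    fun _ hy => ⟨hy.1, (hDG.1 _ _).2 (.inl hy.2)⟩
  Set.ncard_le_ncard_of_injOn C.proj (fun _ hy => hy.2) ((C.injOn_proj x).mono hsub)

theorem ncard_lift_adj_symm_le [Finite V] (hDG : D.IsOrientationOf G) (x : W) :
    {y | (C.lift D).Adj y x}.ncard ≤ Nat.card V :=
  have hsub : {y | (C.lift D).Adj y x} ⊆ {y | C.H.Adj x y ∧ G.Adj (C.proj x) (C.proj y)} :=
    fun _ hy => ⟨hy.1.symm, (hDG.1 _ _).2 (.inr hy.2)⟩
  Set.ncard_univ V ▸ Set.ncard_le_ncard_of_injOn C.proj (fun _ _ => Set.mem_univ _)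
    ((C.injOn_proj x).mono hsub)

theorem even_of_hasWalk_lift (hD : D.IsAcyclic)
    (hpath : ∀ v w : V, D.Adj v w → ∀ n : ℕ, Even n → ¬ D.HasDirectedPath v w n) {x y z : W}
    (hy : (C.lift D).Adj x y) (hz : (C.lift D).Adj x z) {n : ℕ}
    (h : HasWalk (C.lift D).Adj n y z) : Even n := by
  by_contra hn
  have hxz : HasWalk (C.lift D).Adj (n + 1) x z := ⟨y, hy, h⟩
  exact hpath _ _ hz.2 (n + 1) (Nat.even_add_one.2 hn)
    (hasDirectedPath_of_hasWalk hD (hxz.map C.proj fun _ _ h => h.2))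

theorem quasiIndependent_greedySet_lift [Finite W] (hDG : D.IsOrientationOf G)
    (hD : (C.lift D).IsAcyclic) (ω : W → Bool) : C.QuasiIndependent (greedySet hD ω) := by
  rintro v w hvw x ⟨hx, hxv⟩ y ⟨hy, hyw⟩ hxy
  have hG := (C.edge_over v w x hxv y hyw hxy).resolve_left hvw
  rw [C.mem_L_iff] at hxv hyw
  subst hxv hyw
  rcases (hDG.1 _ _).1 hG with h | h
  · exact (mem_greedySet.1 hx).2 y ⟨hxy, h⟩ hy
  · exact (mem_greedySet.1 hy).2 x ⟨hxy.symm, h⟩ hx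

theorem ncard_not_indepFun_mem_greedySet_lift_le [Finite V] [Finite W]
    (hDG : D.IsOrientationOf G) (hD : D.IsAcyclic) (p : W → unitInterval) (x : W) :
    {y | ¬ IndepFun (fun ω => x ∈ greedySet (C.isAcyclic_lift hD) ω)
      (fun ω => y ∈ greedySet (C.isAcyclic_lift hD) ω) (coinMeasure p)}.ncard ≤
      (Nat.card V + 1) ^ Nat.card V * (Nat.card V + 1) ^ Nat.card V := by
  obtain ⟨ρ, hρ, hρn⟩ := exists_rank_of_forall_not_transGen_self hD
  obtain ⟨σ, hσ, hσn⟩ := exists_rank_of_forall_not_transGen_self (r := Function.swap D.Adj)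
    fun v hv => hD v (Relation.transGen_swap.1 hv)
  refine ncard_not_indepFun_mem_greedySet_le _ p
    (fun y => ncard_reflTransGen_le (ρ := ρ ∘ C.proj) (fun _ _ h => hρ _ _ h.2)
      (fun z => (C.ncard_lift_adj_le hDG z).trans (Set.ncard_le_card _)) (hρn _))
    (fun y => ?_) x
  simp only [← Relation.reflTransGen_swap (r := (C.lift D).Adj) (a := y)]
  exact ncard_reflTransGen_le (ρ := σ ∘ C.proj) (fun _ _ h => hσ _ _ h.2)
    (C.ncard_lift_adj_symm_le hDG) (hσn _)

end DPCover

theorem exists_forall_isFold_exists_isColoring {V : Type u} [Finite V] {G : SimpleGraph V}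
    {D : Digraph V} (hDG : D.IsOrientationOf G) (hD : D.IsAcyclic) {d : ℕ} (hd : 0 < d)
    (hdeg : ∀ v, {w | D.Adj v w}.ncard ≤ d)
    (hpath : ∀ v w, D.Adj v w → ∀ n, Even n → ¬ D.HasDirectedPath v w n) {t η : ℝ} (ht : 0 < t)
    (hη : η < (d / t + Real.exp t)⁻¹) :
    ∃ k ≥ 1, ∀ (W : Type u) [Finite W] (C : DPCover G W), C.IsFold k →
      ∃ S, C.IsColoring η S := by
  set q : ℝ := (d / t + Real.exp t)⁻¹
  have hs : 0 < d / t + Real.exp t := by positivity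
  set M := (Nat.card V + 1) ^ Nat.card V * (Nat.card V + 1) ^ Nat.card V
  obtain ⟨k, hk⟩ := exists_nat_gt (Nat.card V * M / (q - η) ^ 2 : ℝ)
  have hk0 : (0 : ℝ) < k := hk.trans_le' (by positivity)
  refine ⟨k, by exact_mod_cast hk0, fun W _ C hC => ?_⟩
  obtain ⟨p, hp⟩ := exists_bias_forall_measureReal_mem_greedySet_eq (C.isAcyclic_lift hD) hd
    (inv_pos.2 hs) ht (inv_mul_cancel₀ hs.ne').le
    (fun x => (C.ncard_lift_adj_le hDG x).trans (hdeg _))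
    fun x y z hy hz n h => C.even_of_hasWalk_lift hD hpath hy hz h
  obtain ⟨ω, hω⟩ := exists_forall_mul_lt_ncard_inter (fun _ => .of_discrete) hp
    (C.ncard_not_indepFun_mem_greedySet_lift_le hDG hD p) hC hη
    ((div_lt_iff₀' (pow_pos (sub_pos.2 hη) 2)).1 hk)
  refine ⟨greedySet (C.isAcyclic_lift hD) ω, C.quasiIndependent_greedySet_lift hDG _ ω, fun v => ?_⟩
  rw [hC v]
  exact (hω v).le

theorem fracDPChromaticNumber_le_ofReal_inv {V : Type u} {G : SimpleGraph V} {k : ℕ} {η : ℝ}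
    (hk : 1 ≤ k) (hη : η ∈ Set.Ioc 0 1)
    (h : ∀ (W : Type u) [Finite W] (C : DPCover G W), C.IsFold k → ∃ S, C.IsColoring η S) :
    fracDPChromaticNumber G ≤ ENNReal.ofReal η⁻¹ := by
  have hθ : η ≤ thetaDP G k := (isGreatest_thetaDP G k).2 ⟨⟨hη.1.le, hη.2⟩, h⟩
  calc fracDPChromaticNumber G ≤ (ENNReal.ofReal (thetaDP G k))⁻¹ := iInf₂_le k hk
    _ ≤ (ENNReal.ofReal η)⁻¹ := by gcongr
    _ = ENNReal.ofReal η⁻¹ := (ENNReal.ofReal_inv_of_pos hη.1).symm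

theorem fracDPChromaticNumber_le_ofReal_div_add_exp {V : Type u} [Finite V] {G : SimpleGraph V}
    {D : Digraph V} (hDG : D.IsOrientationOf G) (hD : D.IsAcyclic) {d : ℕ} (hd : 0 < d)
    (hdeg : ∀ v, {w | D.Adj v w}.ncard ≤ d)
    (hpath : ∀ v w, D.Adj v w → ∀ n, Even n → ¬ D.HasDirectedPath v w n) {t : ℝ} (ht : 0 < t) :
    fracDPChromaticNumber G ≤ ENNReal.ofReal (d / t + Real.exp t) := by
  have hs : 1 ≤ d / t + Real.exp t := le_add_of_nonneg_of_le (by positivity) (Real.one_le_exp ht.le)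
  refine ge_of_tendsto (x := 𝓝[>] (d / t + Real.exp t))
    ENNReal.continuous_ofReal.continuousWithinAt ?_
  filter_upwards [self_mem_nhdsWithin] with s (hst : _ < s)
  have hs1 : 1 ≤ s := hs.trans hst.le
  obtain ⟨k, hk, hcol⟩ := exists_forall_isFold_exists_isColoring hDG hD hd hdeg hpath ht
    (inv_strictAnti₀ (by positivity) hst)
  simpa using fracDPChromaticNumber_le_ofReal_inv hk
    ⟨inv_pos.2 (by positivity), inv_le_one_of_one_le₀ hs1⟩ hcol

theorem two_mul_log_lt_self {x : ℝ} (hx : 0 < x) : 2 * Real.log x < x := by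
  have h := Real.log_le_sub_one_of_pos (half_pos hx)
  rw [Real.log_div hx.ne' two_ne_zero] at h
  linarith [Real.log_two_lt_d9]

theorem tendsto_div_sub_two_mul_log_add_inv :
    Tendsto (fun x : ℝ => x / (x - 2 * Real.log x) + x⁻¹ - 1) atTop (𝓝 0) := by
  have hlog : Tendsto (fun x : ℝ => Real.log x / x) atTop (𝓝 0) :=
    Real.isLittleO_log_id_atTop.tendsto_div_nhds_zero
  have h : Tendsto (fun x : ℝ => (1 - 2 * (Real.log x / x))⁻¹ + x⁻¹ - 1) atTop
      (𝓝 ((1 - 2 * 0)⁻¹ + 0 - 1)) :=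
    (((tendsto_const_nhds.sub (hlog.const_mul 2)).inv₀ (by norm_num)).add
      tendsto_inv_atTop_zero).sub_const 1
  norm_num at h
  refine h.congr' ?_
  filter_upwards [eventually_gt_atTop 0] with x hx
  rw [← mul_div_assoc, one_sub_div hx.ne', inv_div]

theorem theorem1p6 :
    ∃ ε : ℕ → ℝ, Tendsto ε atTop (𝓝 0) ∧
      ∀ d : ℕ, 2 ≤ d →
        ∀ (V : Type u) [Finite V] (G : SimpleGraph V) (D : Digraph V),
          D.IsOrientationOf G →
          D.IsAcyclic →
          (∀ v : V, {w : V | D.Adj v w}.ncard ≤ d) →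
          (∀ v w : V, D.Adj v w → ∀ n : ℕ, Even n → ¬ D.HasDirectedPath v w n) →
          fracDPChromaticNumber G ≤
            ENNReal.ofReal ((1 + ε d) * ((d : ℝ) / Real.log (d : ℝ))) := by
  let δ (x : ℝ) : ℝ := x / (x - 2 * Real.log x) + x⁻¹ - 1
  refine ⟨fun d => δ (Real.log d), tendsto_div_sub_two_mul_log_add_inv.comp
    (Real.tendsto_log_atTop.comp tendsto_natCast_atTop_atTop),
    fun d hd V _ G D hDG hD hdeg hpath => ?_⟩
  have hd0 : (0 : ℝ) < d := by positivity
  have hL : 0 < Real.log d := Real.log_pos (by exact_mod_cast hd)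
  have ht : 0 < Real.log d - 2 * Real.log (Real.log d) := sub_pos.2 (two_mul_log_lt_self hL)
  have hexp : Real.exp (Real.log d - 2 * Real.log (Real.log d)) = d / Real.log d ^ 2 := by
    rw [Real.exp_sub, Real.exp_log hd0, two_mul, Real.exp_add, Real.exp_log hL, sq]
  convert fracDPChromaticNumber_le_ofReal_div_add_exp hDG hD (by omega) hdeg hpath ht using 2
  rw [hexp]
  simp only [δ]
  field_simp
  ring
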